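/- Let $m=4$, $a=4$ and $\lambda=(m-2)/2=1$. For $z>0$ and $\xi\in[-1,1]$, let $$K_4^4(z,\xi)=a^{2\lambda/a}\,\Gamma\!\left(\frac{2\lambda+a}{a}\right)\sum_{k=0}^{\infty}e^{-\frac{i\pi k}{a}}\,\frac{\lambda+k}{\lambda}\,z^{-\lambda}J_{\frac{2(k+\lambda)}{a}}\!\left(\frac2a z^{a/2}\right)C_k^{(\lambda)}(\xi)$$ be the kernel of the radially deformed Fourier transform $\mathcal F_4$ on $\mathbb R^4$, where $z=|x||y|$ and $\xi=\langle x,y\rangle/z$ for nonzero $x,y\in\mathbb R^4$, $J_\nu$ is the Bessel function of the first kind and $C_k^{(\lambda)}$ is the Gegenbauer polynomial. Then the series converges absolutely, the improper integrals $\int_{-\infty}^{u}e^{it^2}\,dt=\lim_{A\to-\infty}\int_A^u e^{it^2}\,dt$ converge for all real $u$, and for all $z>0$ and $\xi=\cos\theta\in[-1,1]$ $$\begin{aligned}K_4^4(z,\xi)&=e^{-iz^2(\xi^2-1/2)}\left(-2iz\xi\int_{-\infty}^{z\xi}e^{it^2}\,dt+e^{iz^2\xi^2}\right)\\&=e^{iz^2/2}-2iz\cos\theta\,e^{-\frac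 i2z^2\cos2\theta}\int_{-\infty}^{z\cos\theta}e^{it^2}\,dt.\end{aligned}$$ Furthermore, $K_4^4(z,1)=\mathcal O(z)$ as $z\to+\infty$. -/

import Mathlib

open Filter Topology

noncomputable section

/-- The Bessel function of the first kind `J_ν(w)` of real order `ν`, at a real `w > 0`, by its
power series. -/
def besselJ (ν w : ℝ) : ℝ :=
  ∑' n : ℕ, (-1 : ℝ) ^ n / ((n.factorial : ℝ) * Real.Gamma (n + ν + 1))
    * (w / 2) ^ (2 * (n : ℝ) + ν)

/-- The Gegenbauer polynomials `C_k^{(lam)}(x)`, by their three-term recurrence. -/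
def gegenbauer (lam x : ℝ) : ℕ → ℝ
  | 0 => 1
  | 1 => 2 * lam * x
  | (k + 2) => (2 * ((k : ℝ) + 1 + lam) * x * gegenbauer lam x (k + 1)
      - ((k : ℝ) + 2 * lam) * gegenbauer lam x k) / ((k : ℝ) + 2)

/-- The index `lam = (m - 2) / 2` belonging to the dimension `m`. -/
def kernelIndex (m : ℕ) : ℝ := ((m : ℝ) - 2) / 2

/-- The `k`-th term of the series of the kernel of the radially deformed Fourier transform on
`ℝ ^ m`, for `m ≠ 2` and `z > 0`, where `z = |x| |y|` and `ξ = ⟨x, y⟩ / z`. -/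
def kernelTerm (m : ℕ) (a z ξ : ℝ) (k : ℕ) : ℂ :=
  Complex.exp (-(Complex.I * Real.pi * k / a))
    * ((kernelIndex m + k) / kernelIndex m * z ^ (-kernelIndex m)
      * besselJ (2 * (k + kernelIndex m) / a) (2 / a * z ^ (a / 2))
      * gegenbauer (kernelIndex m) ξ k : ℝ)

/-- The kernel `K_a^m(z, ξ)` of the radially deformed Fourier transform, as a function of
`z = |x| |y| > 0` and `ξ = ⟨x, y⟩ / z`, for `m ≠ 2`. -/
def radialKernel (m : ℕ) (a z ξ : ℝ) : ℂ :=
  (a ^ (2 * kernelIndex m / a) * Real.Gamma ((2 * kernelIndex m + a) / a) : ℝ)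
    * ∑' k : ℕ, kernelTerm m a z ξ k

/-- The conditionally convergent Fresnel integral `∫_{-∞}^u e^{i t ^ 2} dt`, that is, the limit
of the integrals over `[A, u]` as `A → -∞`. -/
def fresnelIntegral (u : ℝ) : ℂ :=
  limUnder atBot (fun A : ℝ => ∫ t in A..u, Complex.exp (Complex.I * (t : ℂ) ^ 2))

end

/-! Expanding the Bessel functions turns the kernel into a double power series in `kernelRoot * z /
2` with exponents `k + 4 * n`: the phases and the Bessel signs are powers of one eighth root of
unity. It converges absolutely, so it may be summed along `k + 4 * n = N`.

For index 1 the Gegenbauer polynomials are Chebyshev polynomials `U`, and creative telescoping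
(`intCoeff_recurrence`) gives a two-step recurrence for the diagonal sums. After scaling, its
inhomogeneous part is a coefficient of `exp (I * w ^ 2 / 2)` (`kernelCoeff_recurrence`).

Hence `(K - exp (I * w ^ 2 / 2)) / w` solves a first-order linear equation
(`hasDerivAt_kernelRemainder`). An integrating factor reduces it to a Fresnel integral; the value at
0, matched with the half-line integral `√π / 2 * exp (I * π / 4)`, puts the lower limit at `-∞`.
Linear growth at `ξ = 1` follows because the Fresnel integral is bounded at `+∞`. -/

/-! ### Fresnel integrals -/

theorem norm_cexp_neg_mul_sq_le_one {b : ℂ} (hb : 0 ≤ b.re) (t : ℝ) :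
    ‖Complex.exp (-b * (t : ℂ) ^ 2)‖ ≤ 1 := by
  rw [Complex.norm_exp, ← Complex.ofReal_pow, Complex.re_mul_ofReal]
  simpa using mul_nonneg hb (sq_nonneg t)

/-- Integration by parts against `1 / (2 * b * t)`. The bound is uniform in `b`, including on the
imaginary axis, so it survives the limit `b → -I`. -/
theorem norm_integral_cexp_neg_mul_sq_le {b : ℂ} (hb : 0 ≤ b.re) (hb1 : 1 ≤ ‖b‖) {X Y : ℝ}
    (hX : 0 < X) (hXY : X ≤ Y) :
    ‖∫ t in X..Y, Complex.exp (-b * (t : ℂ) ^ 2)‖ ≤ 1 / X := by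
  have hb0 : b ≠ 0 := norm_pos_iff.mp (by linarith)
  have hY : 0 < Y := hX.trans_le hXY
  have hpos : ∀ t ∈ Set.uIcc X Y, 0 < t := fun t ht => by
    rw [Set.uIcc_of_le hXY] at ht
    exact hX.trans_le ht.1
  let F : ℝ → ℂ := fun t => -Complex.exp (-b * (t : ℂ) ^ 2) / (2 * b * t)
  let R : ℝ → ℂ := fun t => Complex.exp (-b * (t : ℂ) ^ 2) / (2 * b * (t : ℂ) ^ 2)
  have hE : Continuous fun t : ℝ => Complex.exp (-b * (t : ℂ) ^ 2) := by fun_prop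
  have hR : ContinuousOn R (Set.uIcc X Y) := by
    refine hE.continuousOn.div (by fun_prop) fun t ht => ?_
    have : (t : ℂ) ≠ 0 := by exact_mod_cast (hpos t ht).ne'
    simp [hb0, this]
  have hF : ∀ t ∈ Set.uIcc X Y,
      HasDerivAt F (Complex.exp (-b * (t : ℂ) ^ 2) + R t) t := fun t ht => by
    have ht0 : (t : ℂ) ≠ 0 := by exact_mod_cast (hpos t ht).ne'
    have h1 : HasDerivAt (fun s : ℝ => (s : ℂ)) 1 t := Complex.ofRealCLM.hasDerivAt
    have h2 := (((h1.pow 2).const_mul (-b)).cexp.neg).div (h1.const_mul (2 * b))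
      (by simp [hb0, ht0] : 2 * b * (t : ℂ) ≠ 0)
    refine h2.congr_deriv ?_
    simp only [R]
    field_simp
    simp
    ring
  have hint := intervalIntegral.integral_eq_sub_of_hasDerivAt hF
    (hE.continuousOn.add hR).intervalIntegrable
  rw [intervalIntegral.integral_add (hE.intervalIntegrable _ _) hR.intervalIntegrable] at hint
  have hg : ∀ t ∈ Set.uIcc X Y, HasDerivAt (fun t : ℝ => -(1 / (2 * t))) (1 / (2 * t ^ 2)) t :=
    fun t ht => by
    have ht0 := (hpos t ht).ne'
    have := (((hasDerivAt_id t).const_mul 2).inv (by simpa using ht0)).neg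
    simp only [one_div]
    refine this.congr_deriv ?_
    simp
    field_simp
  have hgc : ContinuousOn (fun t : ℝ => 1 / (2 * t ^ 2)) (Set.uIcc X Y) :=
    continuousOn_const.div (by fun_prop) fun t ht => by have := hpos t ht; positivity
  have hRint : ‖∫ t in X..Y, R t‖ ≤ 1 / (2 * X) - 1 / (2 * Y) := by
    have h := intervalIntegral.norm_integral_le_of_norm_le (f := R) hXY
      (g := fun t => 1 / (2 * t ^ 2)) (μ := MeasureTheory.volume) ?_ hgc.intervalIntegrable
    · rw [intervalIntegral.integral_eq_sub_of_hasDerivAt hg hgc.intervalIntegrable] at h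
      linarith
    · refine Filter.Eventually.of_forall fun t ht => ?_
      have ht0 : 0 < t := hX.trans ht.1
      simp only [R, norm_div, norm_mul, norm_pow, Complex.norm_real, Real.norm_eq_abs,
        abs_of_pos ht0, Complex.norm_ofNat]
      refine div_le_div₀ zero_le_one (norm_cexp_neg_mul_sq_le_one hb t) (by positivity) ?_
      nlinarith [sq_nonneg t]
  have hFn : ∀ t : ℝ, 0 < t → ‖F t‖ ≤ 1 / (2 * t) := fun t ht0 => by
    simp only [F, norm_div, norm_neg, norm_mul, Complex.norm_real, Real.norm_eq_abs,
      abs_of_pos ht0, Complex.norm_ofNat]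
    refine div_le_div₀ zero_le_one (norm_cexp_neg_mul_sq_le_one hb t) (by positivity) ?_
    nlinarith
  have key : ∫ t in X..Y, Complex.exp (-b * (t : ℂ) ^ 2) = F Y - F X - ∫ t in X..Y, R t :=
    eq_sub_of_add_eq hint
  rw [key]
  have h1 := norm_sub_le (F Y - F X) (∫ t in X..Y, R t)
  have h2 := norm_sub_le (F Y) (F X)
  have h3 : 1 / X = 1 / (2 * X) + 1 / (2 * X) := by field_simp; norm_num
  linarith [hFn X hX, hFn Y hY]

theorem norm_integral_cexp_neg_mul_sq_sub_le {b : ℂ} (hb : 0 < b.re) (hb1 : 1 ≤ ‖b‖) {X : ℝ}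
    (hX : 0 < X) :
    ‖(∫ t in (0 : ℝ)..X, Complex.exp (-b * (t : ℂ) ^ 2)) - (Real.pi / b) ^ (1 / 2 : ℂ) / 2‖
      ≤ 1 / X := by
  have hE : Continuous fun t : ℝ => Complex.exp (-b * (t : ℂ) ^ 2) := by fun_prop
  have hlim := MeasureTheory.intervalIntegral_tendsto_integral_Ioi 0
    (integrable_cexp_neg_mul_sq hb).integrableOn tendsto_id
  rw [integral_gaussian_complex_Ioi hb] at hlim
  refine le_of_tendsto (tendsto_const_nhds.sub hlim).norm ?_
  filter_upwards [eventually_ge_atTop X] with Y hY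
  rw [norm_sub_rev, id, intervalIntegral.integral_interval_sub_left (hE.intervalIntegrable _ _)
    (hE.intervalIntegrable _ _)]
  exact norm_integral_cexp_neg_mul_sq_le hb.le hb1 hX hY

/-- Abel regularisation: take `b = δ - I` in the Gaussian estimate and let `δ → 0+` with `X` fixed.
-/
theorem norm_integral_cexp_I_mul_sq_sub_le {X : ℝ} (hX : 0 < X) :
    ‖(∫ t in (0 : ℝ)..X, Complex.exp (Complex.I * (t : ℂ) ^ 2))
      - (Real.pi / -Complex.I) ^ (1 / 2 : ℂ) / 2‖ ≤ 1 / X := by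
  have hb : Tendsto (fun δ : ℝ => (δ : ℂ) - Complex.I) (𝓝[>] 0) (𝓝 (-Complex.I)) := by
    have : ContinuousAt (fun δ : ℝ => (δ : ℂ) - Complex.I) 0 := by fun_prop
    simpa [ContinuousAt] using this.tendsto.mono_left nhdsWithin_le_nhds
  have hroot : Tendsto (fun δ : ℝ => ((Real.pi : ℂ) / ((δ : ℂ) - Complex.I)) ^ (1 / 2 : ℂ) / 2)
      (𝓝[>] 0) (𝓝 ((Real.pi / -Complex.I) ^ (1 / 2 : ℂ) / 2)) := by
    refine Tendsto.div_const (Tendsto.cpow (tendsto_const_nhds.div hb (by simp))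
      tendsto_const_nhds ?_) 2
    -- The limiting base is `π * I`, off the branch cut because its imaginary part is nonzero.
    right
    simp [Complex.div_im, Real.pi_ne_zero]
  have hint : Tendsto (fun δ : ℝ => ∫ t in (0 : ℝ)..X,
      Complex.exp (-((δ : ℂ) - Complex.I) * (t : ℂ) ^ 2)) (𝓝[>] 0)
      (𝓝 (∫ t in (0 : ℝ)..X, Complex.exp (Complex.I * (t : ℂ) ^ 2))) := by
    have : Continuous fun δ : ℝ => ∫ t in (0 : ℝ)..X,
        Complex.exp (-((δ : ℂ) - Complex.I) * (t : ℂ) ^ 2) :=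
      intervalIntegral.continuous_parametric_intervalIntegral_of_continuous' (by fun_prop) _ _
    simpa using (this.tendsto 0).mono_left nhdsWithin_le_nhds
  refine le_of_tendsto (hint.sub hroot).norm ?_
  filter_upwards [self_mem_nhdsWithin] with δ hδ
  refine norm_integral_cexp_neg_mul_sq_sub_le (by simpa using hδ) ?_ hX
  simpa using Complex.abs_im_le_norm ((δ : ℂ) - Complex.I)

theorem cpow_half_pi_div_neg_I :
    (Real.pi / -Complex.I : ℂ) ^ (1 / 2 : ℂ) =
      Real.sqrt Real.pi * Complex.exp (Complex.I * Real.pi / 4) := by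
  have h : (Real.pi / -Complex.I : ℂ) = (Real.pi : ℂ) * Complex.I := by
    rw [div_neg, Complex.div_I]; ring
  rw [h, Complex.cpow_def_of_ne_zero (by simp [Real.pi_ne_zero]),
    Complex.log_ofReal_mul Real.pi_pos Complex.I_ne_zero, Complex.log_I, Real.sqrt_eq_rpow,
    Real.rpow_def_of_pos Real.pi_pos, Complex.ofReal_exp, ← Complex.exp_add]
  congr 1
  push_cast
  ring

theorem tendsto_integral_cexp_I_mul_sq_atTop :
    Tendsto (fun X : ℝ => ∫ t in (0 : ℝ)..X, Complex.exp (Complex.I * (t : ℂ) ^ 2)) atTop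
      (𝓝 (Real.sqrt Real.pi / 2 * Complex.exp (Complex.I * Real.pi / 4))) := by
  rw [tendsto_iff_norm_sub_tendsto_zero]
  refine squeeze_zero' (Eventually.of_forall fun _ => norm_nonneg _) ?_
    (tendsto_const_nhds.div_atTop tendsto_id : Tendsto (fun X : ℝ => 1 / X) atTop (𝓝 0))
  filter_upwards [eventually_gt_atTop 0] with X hX
  have := norm_integral_cexp_I_mul_sq_sub_le hX
  rwa [cpow_half_pi_div_neg_I, mul_div_right_comm] at this

/-- The integrand is even, so the left half-line contributes as much as the right one. -/
theorem tendsto_integral_cexp_I_mul_sq_atBot (u : ℝ) :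
    Tendsto (fun A : ℝ => ∫ t in A..u, Complex.exp (Complex.I * (t : ℂ) ^ 2)) atBot
      (𝓝 (Real.sqrt Real.pi / 2 * Complex.exp (Complex.I * Real.pi / 4)
        + ∫ t in (0 : ℝ)..u, Complex.exp (Complex.I * (t : ℂ) ^ 2))) := by
  have hE : Continuous fun t : ℝ => Complex.exp (Complex.I * (t : ℂ) ^ 2) := by fun_prop
  refine ((tendsto_integral_cexp_I_mul_sq_atTop.comp tendsto_neg_atBot_atTop).add_const _).congr
    fun A => ?_
  rw [← intervalIntegral.integral_add_adjacent_intervals (hE.intervalIntegrable A 0)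
    (hE.intervalIntegrable 0 u)]
  congr 1
  have := intervalIntegral.integral_comp_neg (a := A) (b := 0)
    (fun t : ℝ => Complex.exp (Complex.I * (t : ℂ) ^ 2))
  simpa using this.symm

theorem fresnelIntegral_eq (u : ℝ) :
    fresnelIntegral u = Real.sqrt Real.pi / 2 * Complex.exp (Complex.I * Real.pi / 4)
        + ∫ t in (0 : ℝ)..u, Complex.exp (Complex.I * (t : ℂ) ^ 2) :=
  (tendsto_integral_cexp_I_mul_sq_atBot u).limUnder_eq

theorem hasDerivAt_fresnelIntegral (u : ℝ) :
    HasDerivAt fresnelIntegral (Complex.exp (Complex.I * (u : ℂ) ^ 2)) u := by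
  have hE : Continuous fun t : ℝ => Complex.exp (Complex.I * (t : ℂ) ^ 2) := by fun_prop
  rw [funext fresnelIntegral_eq]
  exact (hE.integral_hasStrictDerivAt 0 u).hasDerivAt.const_add _

theorem isBigO_fresnelIntegral_one : fresnelIntegral =O[atTop] (fun _ => (1 : ℝ)) := by
  rw [funext fresnelIntegral_eq]
  exact (tendsto_integral_cexp_I_mul_sq_atTop.const_add _).isBigO_one ℝ

/-! ### Double power series of the kernel -/

open Polynomial.Chebyshev in
theorem gegenbauer_one_eq_eval_U (x : ℝ) (k : ℕ) : gegenbauer 1 x k = (U ℝ k).eval x := by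
  induction k using Nat.twoStepInduction with
  | zero => simp [gegenbauer]
  | one => simp [gegenbauer]
  | more k ih0 ih1 =>
    have hk : (k : ℝ) + 2 ≠ 0 := by positivity
    rw [gegenbauer, ih0, ih1]
    push_cast
    rw [U_add_two]
    simp
    field_simp
    ring

/-- A crude geometric bound suffices, since the Gamma factor decays factorially. -/
theorem abs_gegenbauer_one_le {x : ℝ} (hx : x ∈ Set.Icc (-1 : ℝ) 1) (k : ℕ) :
    |gegenbauer 1 x k| ≤ 3 ^ k := by
  have hx1 : |x| ≤ 1 := abs_le.mpr hx
  induction k using Nat.twoStepInduction with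
  | zero => simp [gegenbauer]
  | one => simp [gegenbauer, abs_mul]; linarith
  | more k ih0 ih1 =>
    have hk : (k : ℝ) + 2 ≠ 0 := by positivity
    have h : gegenbauer 1 x (k + 2) = 2 * (x * gegenbauer 1 x (k + 1)) - gegenbauer 1 x k := by
      rw [gegenbauer]
      field_simp
      ring
    have h1 : |x * gegenbauer 1 x (k + 1)| ≤ 3 ^ (k + 1) := by
      rw [abs_mul]
      exact (mul_le_of_le_one_left (abs_nonneg _) hx1).trans ih1
    rw [h]
    rw [pow_succ] at h1
    rw [pow_succ, pow_succ]
    have h3 : (0 : ℝ) < 3 ^ k := by positivity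
    rw [abs_le] at *
    constructor <;> linarith [ih0.1, ih0.2, h1.1, h1.2]

theorem sqrt_pi_div_two_mul_factorial_le_Gamma (m : ℕ) :
    Real.sqrt Real.pi / 2 * m.factorial ≤ Real.Gamma (m + 3 / 2) := by
  induction m with
  | zero =>
    rw [show ((0 : ℕ) : ℝ) + 3 / 2 = 1 / 2 + 1 by norm_num, Real.Gamma_add_one (by norm_num),
      Real.Gamma_one_half_eq]
    simp
    linarith
  | succ m ih =>
    rw [show ((m + 1 : ℕ) : ℝ) + 3 / 2 = (m + 3 / 2) + 1 by push_cast; ring,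
      Real.Gamma_add_one (by positivity), Nat.factorial_succ]
    push_cast
    have h0 : 0 ≤ Real.sqrt Real.pi / 2 * m.factorial := by positivity
    nlinarith

/-- The argument is a half-integer for even `k` and an integer for odd `k`. Independence of `n` lets
the double series be dominated by a product of two single series. -/
theorem sqrt_pi_div_two_mul_factorial_half_le_Gamma (k n : ℕ) :
    Real.sqrt Real.pi / 2 * (k / 2).factorial ≤ Real.Gamma (n + (k + 3) / 2) := by
  rcases Nat.even_or_odd' k with ⟨j, rfl | rfl⟩
  · have h := sqrt_pi_div_two_mul_factorial_le_Gamma (n + j)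
    have hle : ((j.factorial : ℕ) : ℝ) ≤ (n + j).factorial := by
      exact_mod_cast Nat.factorial_le (Nat.le_add_left _ _)
    rw [Nat.mul_div_cancel_left _ two_pos]
    rw [show (n : ℝ) + ((2 * j : ℕ) + 3) / 2 = (n + j : ℕ) + 3 / 2 by push_cast; ring]
    exact (mul_le_mul_of_nonneg_left hle (by positivity)).trans h
  · have hle : ((j.factorial : ℕ) : ℝ) ≤ (n + j + 1).factorial := by
      exact_mod_cast Nat.factorial_le (by omega)
    have hpi : Real.sqrt Real.pi / 2 ≤ 1 := by
      have : Real.sqrt Real.pi ≤ 2 := Real.sqrt_le_iff.mpr ⟨by norm_num, by linarith [Real.pi_le_four]⟩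
      linarith
    rw [show (2 * j + 1) / 2 = j by omega,
      show (n : ℝ) + ((2 * j + 1 : ℕ) + 3) / 2 = (n + j + 1 : ℕ) + 1 by push_cast; ring,
      Real.Gamma_nat_eq_factorial]
    exact (mul_le_of_le_one_left (by positivity) hpi).trans hle

theorem summable_pow_div_factorial_half (y : ℝ) :
    Summable fun k : ℕ => y ^ k / ((k / 2).factorial : ℝ) := by
  have h := Real.summable_pow_div_factorial (y ^ 2)
  refine (HasSum.even_add_odd (f := fun k : ℕ => y ^ k / ((k / 2).factorial : ℝ)) (Summable.hasSum ?_)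
    (Summable.hasSum ?_)).summable
  · refine h.congr fun j => ?_
    rw [Nat.mul_div_cancel_left _ two_pos, pow_mul]
  · refine (h.mul_left y).congr fun j => ?_
    rw [show (2 * j + 1) / 2 = j by omega, pow_succ y (2 * j), pow_mul]
    ring

/-- The coefficient of the double power series expansion of the kernel. -/
noncomputable def doubleCoeff (x : ℝ) (k n : ℕ) : ℝ :=
  (k + 1) * gegenbauer 1 x k / (n.factorial * Real.Gamma (n + (k + 3) / 2))

theorem summable_doubleCoeff {x : ℝ} (hx : x ∈ Set.Icc (-1 : ℝ) 1) (w : ℂ) :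
    Summable fun p : ℕ × ℕ => (doubleCoeff x p.1 p.2 : ℂ) * w ^ (p.1 + 4 * p.2) := by
  have h1 := (summable_pow_div_factorial_half (6 * ‖w‖)).mul_left (2 / Real.sqrt Real.pi)
  have h2 := Real.summable_pow_div_factorial (‖w‖ ^ 4)
  refine Summable.of_norm_bounded (h1.mul_of_nonneg h2 (fun k => ?_) fun n => ?_) fun ⟨k, n⟩ => ?_
  · simp only [Pi.zero_apply]; positivity
  · simp only [Pi.zero_apply]; positivity
  have hs : 0 < Real.sqrt Real.pi := Real.sqrt_pos.mpr Real.pi_pos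
  have hG := sqrt_pi_div_two_mul_factorial_half_le_Gamma k n
  have hG0 : 0 < Real.Gamma (n + (k + 3) / 2) := Real.Gamma_pos_of_pos (by positivity)
  have hk : (k : ℝ) + 1 ≤ 2 ^ k := by exact_mod_cast Nat.lt_two_pow_self
  have hnum : (k + 1) * |gegenbauer 1 x k| ≤ 6 ^ k := by
    rw [show (6 : ℝ) = 2 * 3 by norm_num, mul_pow]
    exact mul_le_mul hk (abs_gegenbauer_one_le hx k) (abs_nonneg _) (by positivity)
  have hc : |doubleCoeff x k n|
      ≤ 6 ^ k / (n.factorial * (Real.sqrt Real.pi / 2 * (k / 2).factorial)) := by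
    rw [doubleCoeff, abs_div, abs_mul, abs_of_pos (by positivity : (0 : ℝ) < k + 1),
      abs_of_pos (by positivity : 0 < n.factorial * Real.Gamma (n + (k + 3) / 2))]
    gcongr
  simp only [norm_mul, norm_pow, Complex.norm_real, Real.norm_eq_abs]
  refine (mul_le_mul_of_nonneg_right hc (by positivity)).trans (le_of_eq ?_)
  rw [mul_pow, pow_add, pow_mul]
  field_simp

/-- The coefficients of the kernel, collected by the power of `z`. -/
noncomputable def diagCoeff (x : ℝ) (N : ℕ) : ℝ :=
  ∑ n ∈ Finset.range (N / 4 + 1), doubleCoeff x (N - 4 * n) n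

/-- The injection `(k, n) ↦ (k + 4 * n, n)`, with extension by zero off its range, makes each
diagonal a fibre with finite support. -/
theorem hasSum_diagCoeff {x : ℝ} (hx : x ∈ Set.Icc (-1 : ℝ) 1) (w : ℂ) :
    HasSum (fun N : ℕ => (diagCoeff x N : ℂ) * w ^ N)
      (∑' p : ℕ × ℕ, (doubleCoeff x p.1 p.2 : ℂ) * w ^ (p.1 + 4 * p.2)) := by
  have hf := (summable_doubleCoeff hx w).hasSum
  let g : ℕ × ℕ → ℂ := fun p =>
    if 4 * p.2 ≤ p.1 then (doubleCoeff x (p.1 - 4 * p.2) p.2 : ℂ) * w ^ p.1 else 0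
  let i : ℕ × ℕ → ℕ × ℕ := fun p => (p.1 + 4 * p.2, p.2)
  have hi : Function.Injective i := fun ⟨a, b⟩ ⟨c, d⟩ h => by
    simp only [i, Prod.mk.injEq] at h ⊢
    omega
  have hg : HasSum g (∑' p : ℕ × ℕ, (doubleCoeff x p.1 p.2 : ℂ) * w ^ (p.1 + 4 * p.2)) := by
    refine (hi.hasSum_iff fun p hp => if_neg fun hle => hp ⟨(p.1 - 4 * p.2, p.2), ?_⟩).mp ?_
    · ext <;> simp [i, hle]
    · convert hf using 2 with p
      simp [i]
  refine hg.prod_fiberwise fun N => ?_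
  have hfin := hasSum_sum_of_ne_finset_zero (L := .unconditional ℕ) (f := fun n => g (N, n))
    (s := Finset.range (N / 4 + 1)) fun n hn => if_neg fun hle => hn ?_
  · convert hfin using 1
    rw [diagCoeff, Complex.ofReal_sum, Finset.sum_mul]
    refine Finset.sum_congr rfl fun n hn => ?_
    rw [Finset.mem_range] at hn
    exact (if_pos (by simp only; omega)).symm
  · simp only at hle
    rw [Finset.mem_range]
    omega

/-- The Bessel argument halved is `(z / 2) ^ 2`, which makes the exponent an integer; the split-off
`z` cancels `z ^ (-1)` in the kernel. -/
theorem besselJ_term_eq {z : ℝ} (hz : 0 < z) (k n : ℕ) :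
    (2 / 4 * z ^ ((4 : ℝ) / 2) / 2) ^ (2 * (n : ℝ) + 2 * (k + 1) / 4)
      = z * ((1 / 2) * (z / 2) ^ (k + 4 * n)) := by
  have h : 2 / 4 * z ^ ((4 : ℝ) / 2) / 2 = (z / 2) ^ (2 : ℝ) := by
    rw [show (4 : ℝ) / 2 = 2 by norm_num, Real.rpow_two, Real.rpow_two]
    ring
  rw [h, ← Real.rpow_mul (by positivity),
    show 2 * (2 * (n : ℝ) + 2 * (k + 1) / 4) = ((k + 4 * n + 1 : ℕ) : ℝ) by push_cast; ring,
    Real.rpow_natCast, pow_succ]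
  ring

theorem kernelIndex_four : kernelIndex 4 = 1 := by
  norm_num [kernelIndex]

/-- The primitive eighth root of unity by which `z` is rotated. -/
noncomputable def kernelRoot : ℂ := Complex.exp (-(Complex.I * Real.pi / 4))

theorem kernelRoot_sq : kernelRoot ^ 2 = -Complex.I := by
  rw [kernelRoot, ← Complex.exp_nat_mul,
    show ((2 : ℕ) : ℂ) * (-(Complex.I * Real.pi / 4)) = -(Real.pi / 2 * Complex.I) by
      push_cast; ring, Complex.exp_neg, Complex.exp_pi_div_two_mul_I, Complex.inv_I]

theorem kernelRoot_pow_four : kernelRoot ^ 4 = -1 := by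
  rw [show 4 = 2 * 2 by norm_num, pow_mul, kernelRoot_sq, neg_sq, Complex.I_sq]

theorem kernelTerm_four_eq {z : ℝ} (hz : 0 < z) (x : ℝ) (k : ℕ) :
    kernelTerm 4 4 z x k =
      ∑' n : ℕ, 1 / 2 * ((doubleCoeff x k n : ℂ) * (kernelRoot * z / 2) ^ (k + 4 * n)) := by
  have hexp : Complex.exp (-(Complex.I * Real.pi * k / (4 : ℝ))) = kernelRoot ^ k := by
    rw [kernelRoot, ← Complex.exp_nat_mul]
    congr 1
    push_cast
    ring
  have hz0 : (z : ℂ) ≠ 0 := by exact_mod_cast hz.ne'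
  rw [kernelTerm, hexp, kernelIndex_four, besselJ, ← tsum_mul_left, ← tsum_mul_right,
    Complex.ofReal_tsum, ← tsum_mul_left]
  refine tsum_congr fun n => ?_
  rw [besselJ_term_eq hz, doubleCoeff, Real.rpow_neg_one,
    show (n : ℝ) + 2 * (k + 1) / 4 + 1 = n + (k + 3) / 2 by ring]
  have hpow : (kernelRoot * z / 2) ^ (k + 4 * n)
      = kernelRoot ^ k * (-1) ^ n * ((z : ℂ) / 2) ^ (k + 4 * n) := by
    rw [mul_div_assoc, mul_pow, pow_add kernelRoot, pow_mul, kernelRoot_pow_four]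
  rw [hpow]
  push_cast
  generalize ((z : ℂ) / 2) ^ (k + 4 * n) = q
  field_simp
  ring

theorem summable_kernelTerm_four {z : ℝ} (hz : 0 < z) {x : ℝ} (hx : x ∈ Set.Icc (-1 : ℝ) 1) :
    Summable (kernelTerm 4 4 z x) := by
  have h := (summable_doubleCoeff hx (kernelRoot * z / 2)).mul_left (1 / 2)
  exact h.prod.congr fun k => (kernelTerm_four_eq hz x k).symm

theorem hasSum_radialKernel_four {z : ℝ} (hz : 0 < z) {x : ℝ} (hx : x ∈ Set.Icc (-1 : ℝ) 1) :
    HasSum (fun N : ℕ => Real.sqrt Real.pi / 2 * ((diagCoeff x N : ℂ) * (kernelRoot * z / 2) ^ N))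
      (radialKernel 4 4 z x) := by
  have h := (summable_doubleCoeff hx (kernelRoot * z / 2)).mul_left (1 / 2)
  have h2 := ((hasSum_diagCoeff hx (kernelRoot * z / 2)).mul_left
    (Real.sqrt Real.pi / 2 : ℂ))
  have hK : radialKernel 4 4 z x = Real.sqrt Real.pi / 2 *
      ∑' p : ℕ × ℕ, (doubleCoeff x p.1 p.2 : ℂ) * (kernelRoot * z / 2) ^ (p.1 + 4 * p.2) := by
    rw [radialKernel, tsum_congr (kernelTerm_four_eq hz x), ← h.tsum_prod, tsum_mul_left,
      kernelIndex_four, show (2 * 1 + 4 : ℝ) / 4 = 1 / 2 + 1 by norm_num,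
      Real.Gamma_add_one (by norm_num), Real.Gamma_one_half_eq,
      show (2 * 1 : ℝ) / 4 = 1 / 2 by norm_num, ← Real.sqrt_eq_rpow,
      show (4 : ℝ) = 2 ^ 2 by norm_num, Real.sqrt_sq (by norm_num)]
    push_cast
    ring
  rwa [hK]

/-! ### Recurrence for the diagonal sums -/

/-- The double power series coefficient, with a first index that may be negative. -/
noncomputable def intCoeff (x : ℝ) (k : ℤ) (n : ℕ) : ℝ :=
  (k + 1) * (Polynomial.Chebyshev.U ℝ k).eval x / (n.factorial * Real.Gamma (n + (k + 3) / 2))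

/-- The boundary term of the recurrence between diagonal sums of `intCoeff`. -/
noncomputable def intBoundary (x : ℝ) (k : ℤ) (n : ℕ) : ℝ :=
  2 * (k + 3) * n * (Polynomial.Chebyshev.U ℝ k).eval x
    / (n.factorial * Real.Gamma (n + (k + 3) / 2))

theorem doubleCoeff_eq_intCoeff (x : ℝ) (k n : ℕ) : doubleCoeff x k n = intCoeff x k n := by
  rw [doubleCoeff, intCoeff, gegenbauer_one_eq_eval_U, Int.cast_natCast]

open Polynomial.Chebyshev in
-- This is `2 * T_2 * U_{k-2} = U_k + U_{k-4}`; a step of 4 in the index matches the diagonals.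
theorem two_mul_two_mul_sq_sub_one_mul_eval_U (x : ℝ) (k : ℤ) :
    2 * (2 * x ^ 2 - 1) * (U ℝ (k - 2)).eval x = (U ℝ k).eval x + (U ℝ (k - 4)).eval x := by
  have h1 := congrArg (Polynomial.eval x) (U_add_two ℝ (k - 2))
  have h2 := congrArg (Polynomial.eval x) (U_add_two ℝ (k - 3))
  have h3 := congrArg (Polynomial.eval x) (U_add_two ℝ (k - 4))
  rw [show k - 2 + 2 = k by ring, show k - 2 + 1 = k - 1 by ring] at h1
  rw [show k - 3 + 2 = k - 1 by ring, show k - 3 + 1 = k - 2 by ring] at h2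
  rw [show k - 4 + 2 = k - 2 by ring, show k - 4 + 1 = k - 3 by ring] at h3
  simp only [Polynomial.eval_sub, Polynomial.eval_mul, Polynomial.eval_ofNat,
    Polynomial.eval_X] at h1 h2 h3
  linear_combination -h1 - 2 * x * h2 - h3

/-- The telescoping certificate: at `k = N - 4 * n` the bracket is a forward difference in `n`. All
Gamma values reduce to the one at `n + (k + 1) / 2`, leaving the Chebyshev identity. -/
theorem intCoeff_recurrence (x : ℝ) (k : ℤ) (n : ℕ) (h : 0 < (n : ℝ) + (k + 1) / 2) :
    4 * (2 * x ^ 2 - 1) * intCoeff x (k - 2) n =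
      (k + 4 * n - 1) * intCoeff x k n + (intBoundary x (k - 4) (n + 1) - intBoundary x k n) := by
  have hU := two_mul_two_mul_sq_sub_one_mul_eval_U x k
  have hG0 := (Real.Gamma_pos_of_pos h).ne'
  have hG : Real.Gamma (n + (k + 3) / 2) = (n + (k + 1) / 2) * Real.Gamma (n + (k + 1) / 2) := by
    rw [← Real.Gamma_add_one h.ne']
    congr 1
    ring
  have hf : (n.factorial : ℝ) ≠ 0 := by positivity
  have hn : (n : ℝ) + 1 ≠ 0 := by positivity
  have h0 : (2 * n : ℝ) + (k + 1) ≠ 0 := by linarith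
  simp only [intCoeff, intBoundary]
  rw [hG, Nat.factorial_succ]
  push_cast
  rw [show (n : ℝ) + (k - 2 + 3) / 2 = n + (k + 1) / 2 by ring,
    show (n : ℝ) + 1 + (k - 4 + 3) / 2 = n + (k + 1) / 2 by ring]
  generalize Real.Gamma (n + (k + 1) / 2) = G at *
  field_simp
  linear_combination (2 * (2 * n + (k + 1)) * (k - 1) : ℝ) * hU

/-- The lower boundary term vanishes by its factor `n`. The hypothesis keeps the Gamma arguments
positive at each step while allowing the index `N - 4 * M` to be negative. -/
theorem sum_intCoeff_recurrence (x : ℝ) (N : ℤ) (M : ℕ) (h : 2 * (M : ℤ) < N + 3) :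
    4 * (2 * x ^ 2 - 1) * ∑ n ∈ Finset.range M, intCoeff x (N - 2 - 4 * n) n =
      (N - 1) * ∑ n ∈ Finset.range M, intCoeff x (N - 4 * n) n + intBoundary x (N - 4 * M) M := by
  induction M with
  | zero => simp [intBoundary]
  | succ M ih =>
    have hM : 0 < (M : ℝ) + ((N - 4 * M : ℤ) + 1) / 2 := by
      have : ((2 * (M + 1 : ℕ) : ℤ) : ℝ) < (N + 3 : ℤ) := by exact_mod_cast h
      push_cast at this ⊢
      linarith
    have hr := intCoeff_recurrence x (N - 4 * M) M hM
    rw [Finset.sum_range_succ, Finset.sum_range_succ, mul_add, ih (by push_cast at h; omega),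
      show N - 2 - 4 * (M : ℤ) = N - 4 * M - 2 by ring, hr,
      show N - 4 * ((M + 1 : ℕ) : ℤ) = N - 4 * M - 4 by push_cast; ring]
    push_cast
    ring

theorem diagCoeff_eq_sum_intCoeff (x : ℝ) (N : ℕ) :
    diagCoeff x N = ∑ n ∈ Finset.range (N / 4 + 1), intCoeff x (N - 4 * n) n := by
  refine Finset.sum_congr rfl fun n hn => ?_
  rw [Finset.mem_range] at hn
  rw [doubleCoeff_eq_intCoeff]
  congr 1
  push_cast [show 4 * n ≤ N by omega]
  rfl

/-- Legendre's duplication formula at `p + 1`. -/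
theorem factorial_mul_Gamma_add_three_halves (p : ℕ) :
    p.factorial * Real.Gamma (p + 3 / 2)
      = (2 * p + 1).factorial * Real.sqrt Real.pi / (2 * 4 ^ p) := by
  have h := Real.Gamma_mul_Gamma_add_half (p + 1)
  rw [Real.Gamma_nat_eq_factorial, show (p : ℝ) + 1 + 1 / 2 = p + 3 / 2 by ring,
    show 2 * ((p : ℝ) + 1) = (2 * p + 1 : ℕ) + 1 by push_cast; ring,
    Real.Gamma_nat_eq_factorial,
    show 1 - (((2 * p + 1 : ℕ) : ℝ) + 1) = -((2 * p + 1 : ℕ) : ℝ) by ring,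
    Real.rpow_neg two_pos.le, Real.rpow_natCast, pow_succ, pow_mul] at h
  rw [h]
  norm_num
  field_simp

theorem factorial_succ_mul_Gamma_add_three_halves (p : ℕ) :
    (p + 1).factorial * Real.Gamma (p + 3 / 2)
      = (2 * p + 2).factorial * Real.sqrt Real.pi / (4 * 4 ^ p) := by
  have h := factorial_mul_Gamma_add_three_halves p
  rw [Nat.factorial_succ, Nat.factorial_succ (2 * p + 1)]
  push_cast
  rw [mul_assoc, h]
  field_simp
  ring

/-- The telescoped sum ends at index `-2`, where `U_{-2} = -1` produces the inhomogeneous term. -/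
theorem diagCoeff_four_mul_add_two (x : ℝ) (p : ℕ) :
    ((4 * p : ℕ) + 1) * diagCoeff x (4 * p + 2) = 4 * (2 * x ^ 2 - 1) * diagCoeff x (4 * p)
      + 4 * 4 ^ p / ((2 * p + 1).factorial * Real.sqrt Real.pi) := by
  have h := sum_intCoeff_recurrence x (4 * p + 2) (p + 1) (by push_cast; omega)
  have hb : intBoundary x (4 * p + 2 - 4 * (p + 1 : ℕ)) (p + 1)
      = -(4 * 4 ^ p / ((2 * p + 1).factorial * Real.sqrt Real.pi)) := by
    have hG := factorial_mul_Gamma_add_three_halves p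
    rw [show (4 * p + 2 - 4 * (p + 1 : ℕ) : ℤ) = -2 by push_cast; ring, intBoundary,
      Polynomial.Chebyshev.U_neg_two, Nat.factorial_succ]
    push_cast
    rw [show (p : ℝ) + 1 + (-2 + 3) / 2 = p + 3 / 2 by ring, mul_assoc ((p : ℝ) + 1), hG]
    simp
    field_simp
    ring
  rw [hb] at h
  rw [diagCoeff_eq_sum_intCoeff, diagCoeff_eq_sum_intCoeff, show (4 * p + 2) / 4 = p by omega,
    show 4 * p / 4 = p by omega]
  push_cast at h ⊢
  simp only [show ∀ n : ℤ, 4 * (p : ℤ) + 2 - 2 - n = 4 * p - n from fun n => by ring] at h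
  linear_combination -h

/-- The boundary term sits at index `-1`, where `U` vanishes. -/
theorem diagCoeff_four_mul_add_three (x : ℝ) (p : ℕ) :
    ((4 * p + 1 : ℕ) + 1) * diagCoeff x (4 * p + 1 + 2)
      = 4 * (2 * x ^ 2 - 1) * diagCoeff x (4 * p + 1) := by
  have h := sum_intCoeff_recurrence x (4 * p + 3) (p + 1) (by push_cast; omega)
  have hb : intBoundary x (4 * p + 3 - 4 * (p + 1 : ℕ)) (p + 1) = 0 := by
    rw [show (4 * p + 3 - 4 * (p + 1 : ℕ) : ℤ) = -1 by push_cast; ring, intBoundary,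
      Polynomial.Chebyshev.U_neg_one]
    simp
  rw [hb] at h
  rw [diagCoeff_eq_sum_intCoeff, diagCoeff_eq_sum_intCoeff, show (4 * p + 1 + 2) / 4 = p by omega,
    show (4 * p + 1) / 4 = p by omega]
  push_cast at h ⊢
  simp only [show ∀ n : ℤ, 4 * (p : ℤ) + 3 - 2 - n = 4 * p + 1 - n from fun n => by ring] at h
  simp only [show ∀ n : ℤ, 4 * (p : ℤ) + 1 + 2 - n = 4 * p + 3 - n from fun n => by ring]
  linear_combination -h

/-- The left diagonal has one more entry, at index 0, than the right one; that entry and the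
boundary term combine into the inhomogeneity. -/
theorem diagCoeff_four_mul_add_four (x : ℝ) (p : ℕ) :
    ((4 * p + 2 : ℕ) + 1) * diagCoeff x (4 * p + 2 + 2)
      = 4 * (2 * x ^ 2 - 1) * diagCoeff x (4 * p + 2)
        - 8 * 4 ^ p / ((2 * p + 2).factorial * Real.sqrt Real.pi) := by
  have h := sum_intCoeff_recurrence x (4 * p + 4) (p + 1) (by push_cast; omega)
  have hk : (4 * p + 4 - 4 * (p + 1 : ℕ) : ℤ) = 0 := by push_cast; ring
  have hb : intBoundary x 0 (p + 1) - (4 * p + 3) * intCoeff x 0 (p + 1)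
      = 8 * 4 ^ p / ((2 * p + 2).factorial * Real.sqrt Real.pi) := by
    have hG := factorial_succ_mul_Gamma_add_three_halves p
    have hG1 : Real.Gamma (p + 1 + 3 / 2) = (p + 3 / 2) * Real.Gamma (p + 3 / 2) := by
      rw [← Real.Gamma_add_one (by positivity)]
      congr 1
      ring
    rw [intBoundary, intCoeff, Polynomial.Chebyshev.U_zero]
    push_cast
    rw [zero_add, hG1, mul_left_comm, hG]
    simp
    field_simp
    ring
  rw [hk] at h
  rw [diagCoeff_eq_sum_intCoeff, diagCoeff_eq_sum_intCoeff,
    show (4 * p + 2 + 2) / 4 = p + 1 by omega, show (4 * p + 2) / 4 = p by omega,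
    Finset.sum_range_succ _ (p + 1),
    show ((4 * p + 2 + 2 : ℕ) - 4 * (p + 1 : ℕ) : ℤ) = 0 by push_cast; ring]
  push_cast at h ⊢
  simp only [show ∀ n : ℤ, 4 * (p : ℤ) + 4 - 2 - n = 4 * p + 2 - n from fun n => by ring] at h
  simp only [show ∀ n : ℤ, 4 * (p : ℤ) + 2 + 2 - n = 4 * p + 4 - n from fun n => by ring]
  linear_combination -h - hb

/-- Here the extra entry, at index 1, cancels the boundary term exactly. -/
theorem diagCoeff_four_mul_add_five (x : ℝ) (p : ℕ) :
    ((4 * p + 3 : ℕ) + 1) * diagCoeff x (4 * p + 3 + 2)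
      = 4 * (2 * x ^ 2 - 1) * diagCoeff x (4 * p + 3) := by
  have h := sum_intCoeff_recurrence x (4 * p + 5) (p + 1) (by push_cast; omega)
  have hk : (4 * p + 5 - 4 * (p + 1 : ℕ) : ℤ) = 1 := by push_cast; ring
  have hb : intBoundary x 1 (p + 1) = (4 * p + 4) * intCoeff x 1 (p + 1) := by
    rw [intBoundary, intCoeff]
    push_cast
    ring
  rw [hk, hb] at h
  rw [diagCoeff_eq_sum_intCoeff, diagCoeff_eq_sum_intCoeff,
    show (4 * p + 3 + 2) / 4 = p + 1 by omega, show (4 * p + 3) / 4 = p by omega,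
    Finset.sum_range_succ _ (p + 1),
    show ((4 * p + 3 + 2 : ℕ) - 4 * (p + 1 : ℕ) : ℤ) = 1 by push_cast; ring]
  push_cast at h ⊢
  simp only [show ∀ n : ℤ, 4 * (p : ℤ) + 5 - 2 - n = 4 * p + 3 - n from fun n => by ring] at h
  simp only [show ∀ n : ℤ, 4 * (p : ℤ) + 3 + 2 - n = 4 * p + 5 - n from fun n => by ring]
  linear_combination -h

/-! ### Power series coefficients of the kernel -/

/-- The power series coefficients of the kernel. -/
noncomputable def kernelCoeff (x : ℝ) (N : ℕ) : ℂ :=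
  Real.sqrt Real.pi / 2 * (diagCoeff x N * (kernelRoot / 2) ^ N)

/-- The power series coefficients of `w ↦ exp (I * w ^ 2 / 2)`. -/
noncomputable def expCoeff (N : ℕ) : ℂ :=
  if Even N then (Complex.I / 2) ^ (N / 2) / (N / 2).factorial else 0

theorem expCoeff_two_mul (j : ℕ) : expCoeff (2 * j) = (Complex.I / 2) ^ j / j.factorial := by
  simp [expCoeff]

theorem expCoeff_two_mul_add_one (j : ℕ) : expCoeff (2 * j + 1) = 0 := by
  simp [expCoeff]

theorem add_two_mul_expCoeff_add_two (N : ℕ) :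
    ((N : ℂ) + 2) * expCoeff (N + 2) = Complex.I * expCoeff N := by
  rcases Nat.even_or_odd' N with ⟨j, rfl | rfl⟩
  · have h1 : (j : ℂ) + 1 ≠ 0 := by exact_mod_cast j.succ_ne_zero
    have h2 : (j.factorial : ℂ) ≠ 0 := by exact_mod_cast j.factorial_ne_zero
    rw [show 2 * j + 2 = 2 * (j + 1) by ring, expCoeff_two_mul, expCoeff_two_mul,
      Nat.factorial_succ, pow_succ]
    push_cast
    field_simp
  · rw [show 2 * j + 1 + 2 = 2 * (j + 1) + 1 by ring, expCoeff_two_mul_add_one,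
      expCoeff_two_mul_add_one, mul_zero, mul_zero]

theorem hasSum_expCoeff (w : ℂ) :
    HasSum (fun N : ℕ => expCoeff N * w ^ N) (Complex.exp (Complex.I * w ^ 2 / 2)) := by
  rw [← add_zero (Complex.exp _)]
  refine HasSum.even_add_odd ?_ ?_
  · have h := NormedSpace.expSeries_div_hasSum_exp (Complex.I * w ^ 2 / 2)
    rw [← Complex.exp_eq_exp_ℂ] at h
    have he : ∀ j : ℕ, expCoeff (2 * j) * w ^ (2 * j)
        = (Complex.I * w ^ 2 / 2) ^ j / j.factorial := fun j => by
      rw [expCoeff_two_mul, pow_mul, div_mul_eq_mul_div, ← mul_pow]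
      congr 2
      ring
    simp only [he]
    exact h
  · simp_rw [expCoeff_two_mul_add_one, zero_mul]
    exact hasSum_zero

/-- Rescaling by `(kernelRoot / 2) ^ 2 = -I / 4` turns the factor 4 into `-I`; `hB` identifies the
rescaled inhomogeneity. -/
theorem kernelCoeff_add_two (x : ℝ) (N : ℕ) (B : ℝ)
    (h : ((N : ℝ) + 1) * diagCoeff x (N + 2) = 4 * (2 * x ^ 2 - 1) * diagCoeff x N + B)
    (hB : Real.sqrt Real.pi * B / 8 * Complex.I * (kernelRoot / 2) ^ N = expCoeff (N + 2)) :
    ((N : ℂ) + 1) * kernelCoeff x (N + 2) =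
      -(Complex.I * (2 * x ^ 2 - 1) * kernelCoeff x N) - expCoeff (N + 2) := by
  have h' := congrArg (fun r : ℝ => (r : ℂ)) h
  push_cast at h'
  rw [← hB, kernelCoeff, kernelCoeff, pow_add, div_pow kernelRoot 2 2, kernelRoot_sq]
  linear_combination
    (-(Real.sqrt Real.pi / 8 * Complex.I * (kernelRoot / 2) ^ N) : ℂ) * h'

theorem kernelRoot_div_two_pow_four : (kernelRoot / 2) ^ 4 = -1 / 16 := by
  rw [div_pow, kernelRoot_pow_four]
  norm_num

theorem kernelCoeff_recurrence (x : ℝ) (N : ℕ) :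
    ((N : ℂ) + 1) * kernelCoeff x (N + 2) =
      -(Complex.I * (2 * x ^ 2 - 1) * kernelCoeff x N) - expCoeff (N + 2) := by
  have hs : (Real.sqrt Real.pi : ℂ) ≠ 0 := by
    exact_mod_cast (Real.sqrt_pos.mpr Real.pi_pos).ne'
  have hI : ∀ p : ℕ, (Complex.I / 2) ^ (2 * p) = (-1 / 16) ^ p * 4 ^ p := fun p => by
    rw [pow_mul, ← mul_pow, div_pow, Complex.I_sq]
    norm_num
  obtain ⟨p, r, hr, rfl⟩ : ∃ p r, r < 4 ∧ N = 4 * p + r :=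
    ⟨N / 4, N % 4, Nat.mod_lt _ (by norm_num), by omega⟩
  interval_cases r
  · refine kernelCoeff_add_two x _ _ (diagCoeff_four_mul_add_two x p) ?_
    have hf : ((2 * p + 1).factorial : ℂ) ≠ 0 := by exact_mod_cast Nat.factorial_ne_zero _
    rw [show 4 * p + 0 + 2 = 2 * (2 * p + 1) by ring, expCoeff_two_mul, pow_succ, hI, add_zero,
      pow_mul, kernelRoot_div_two_pow_four]
    push_cast
    field_simp
    ring
  · refine kernelCoeff_add_two x _ 0 (by rw [diagCoeff_four_mul_add_three, add_zero]) ?_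
    rw [show 4 * p + 1 + 2 = 2 * (2 * p + 1) + 1 by ring, expCoeff_two_mul_add_one]
    simp
  · refine kernelCoeff_add_two x _ _ (diagCoeff_four_mul_add_four x p) ?_
    have hf : ((2 * p + 2).factorial : ℂ) ≠ 0 := by exact_mod_cast Nat.factorial_ne_zero _
    rw [show 4 * p + 2 + 2 = 2 * (2 * p + 2) by ring, expCoeff_two_mul,
      pow_add (Complex.I / 2), hI, pow_add,
      pow_mul, kernelRoot_div_two_pow_four, div_pow Complex.I, div_pow kernelRoot, kernelRoot_sq]
    push_cast
    field_simp
  · refine kernelCoeff_add_two x _ 0 (by rw [diagCoeff_four_mul_add_five, add_zero]) ?_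
    rw [show 4 * p + 3 + 2 = 2 * (2 * p + 2) + 1 by ring, expCoeff_two_mul_add_one]
    simp

theorem kernelCoeff_zero (x : ℝ) : kernelCoeff x 0 = 1 := by
  have hs : Real.sqrt Real.pi ≠ 0 := (Real.sqrt_pos.mpr Real.pi_pos).ne'
  have h : diagCoeff x 0 = 2 / Real.sqrt Real.pi := by
    simp only [diagCoeff, doubleCoeff]
    norm_num [gegenbauer]
    rw [show (3 : ℝ) / 2 = 1 / 2 + 1 by norm_num, Real.Gamma_add_one (by norm_num),
      Real.Gamma_one_half_eq]
    field_simp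
  rw [kernelCoeff, h]
  have hs' : (Real.sqrt Real.pi : ℂ) ≠ 0 := by exact_mod_cast hs
  push_cast
  field_simp

theorem kernelCoeff_one (x : ℝ) : kernelCoeff x 1 = Real.sqrt Real.pi * x * kernelRoot := by
  have h : diagCoeff x 1 = 4 * x := by
    simp only [diagCoeff, doubleCoeff]
    norm_num [gegenbauer]
    ring
  rw [kernelCoeff, h]
  push_cast
  ring

theorem hasSum_kernelCoeff {z : ℝ} (hz : 0 < z) {x : ℝ} (hx : x ∈ Set.Icc (-1 : ℝ) 1) :
    HasSum (fun N : ℕ => kernelCoeff x N * (z : ℂ) ^ N) (radialKernel 4 4 z x) := by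
  convert hasSum_radialKernel_four hz hx using 2 with N
  rw [kernelCoeff, mul_div_right_comm, mul_pow]
  ring

theorem summable_kernelCoeff {x : ℝ} (hx : x ∈ Set.Icc (-1 : ℝ) 1) (w : ℂ) :
    Summable fun N : ℕ => kernelCoeff x N * w ^ N := by
  refine ((hasSum_diagCoeff hx (kernelRoot * w / 2)).summable.mul_left
    (Real.sqrt Real.pi / 2 : ℂ)).congr fun N => ?_
  rw [kernelCoeff, mul_div_right_comm, mul_pow]
  ring

/-! ### Differential equation for the kernel -/

theorem hasDerivAt_tsum_mul_pow {a : ℕ → ℂ} (ha : ∀ w : ℂ, Summable fun N => a N * w ^ N)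
    (w : ℂ) :
    HasDerivAt (fun w : ℂ => ∑' N, a N * w ^ N) (∑' N : ℕ, ((N : ℂ) + 1) * a (N + 1) * w ^ N) w := by
  set R : ℝ := ‖w‖ + 1 with hR
  have hR1 : 1 ≤ R := by linarith [norm_nonneg w]
  -- Doubling the radius absorbs the factor `N ≤ 2 ^ N` from differentiation.
  have hu : Summable fun N : ℕ => ‖a N * ((2 * R : ℝ) : ℂ) ^ N‖ := (ha _).norm
  have hbound : ∀ (N : ℕ) (y : ℂ), y ∈ Metric.ball (0 : ℂ) R →
      ‖a N * (N * y ^ (N - 1))‖ ≤ ‖a N * ((2 * R : ℝ) : ℂ) ^ N‖ := fun N y hy => by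
    have hyR : ‖y‖ ≤ R := (mem_ball_zero_iff.mp hy).le
    rw [norm_mul, norm_mul, norm_mul, norm_pow, norm_pow, Complex.norm_natCast,
      Complex.norm_of_nonneg (by linarith : 0 ≤ 2 * R)]
    refine mul_le_mul_of_nonneg_left ?_ (norm_nonneg _)
    rw [mul_pow]
    refine mul_le_mul (by exact_mod_cast Nat.lt_two_pow_self.le) ?_ (by positivity) (by positivity)
    exact (pow_le_pow_left₀ (norm_nonneg _) hyR _).trans
      (pow_le_pow_right₀ hR1 (Nat.sub_le _ _))
  have hw : w ∈ Metric.ball (0 : ℂ) R := mem_ball_zero_iff.mpr (by linarith)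
  have h := hasDerivAt_tsum_of_isPreconnected (g := fun N y => a N * y ^ N)
    (g' := fun N y => a N * (N * y ^ (N - 1))) hu Metric.isOpen_ball
    (convex_ball (0 : ℂ) R).isPreconnected
    (fun N y _ => (hasDerivAt_pow N y).const_mul (a N)) hbound hw (ha w) hw
  refine h.congr_deriv ?_
  rw [(Summable.of_norm_bounded hu fun N => hbound N w hw).tsum_eq_zero_add]
  simp only [Nat.cast_zero, zero_mul, mul_zero, zero_add]
  refine tsum_congr fun N => ?_
  push_cast
  ring

/-- The coefficients of the kernel with the exponential `exp (I * z ^ 2 / 2)` removed. -/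
noncomputable def remainderCoeff (x : ℝ) (N : ℕ) : ℂ := kernelCoeff x N - expCoeff N

theorem remainderCoeff_zero (x : ℝ) : remainderCoeff x 0 = 0 := by
  simp [remainderCoeff, kernelCoeff_zero, expCoeff]

theorem remainderCoeff_one (x : ℝ) :
    remainderCoeff x 1 = Real.sqrt Real.pi * x * kernelRoot := by
  simp [remainderCoeff, kernelCoeff_one, expCoeff]

/-- After division by `w`, the left side is the `N`-th coefficient of a derivative, so this is a
first-order equation in coefficient form. -/
theorem remainderCoeff_recurrence (x : ℝ) (N : ℕ) :
    ((N : ℂ) + 1) * remainderCoeff x (N + 2) =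
      -(Complex.I * (2 * x ^ 2 - 1)) * remainderCoeff x N - 2 * Complex.I * x ^ 2 * expCoeff N := by
  have h1 := kernelCoeff_recurrence x N
  have h2 := add_two_mul_expCoeff_add_two N
  rw [remainderCoeff, remainderCoeff]
  linear_combination h1 - h2

theorem summable_remainderCoeff {x : ℝ} (hx : x ∈ Set.Icc (-1 : ℝ) 1) (w : ℂ) :
    Summable fun N => remainderCoeff x N * w ^ N :=
  ((summable_kernelCoeff hx w).sub (hasSum_expCoeff w).summable).congr fun N => by
    rw [remainderCoeff, sub_mul]

theorem summable_remainderCoeff_succ {x : ℝ} (hx : x ∈ Set.Icc (-1 : ℝ) 1) (w : ℂ) :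
    Summable fun N => remainderCoeff x (N + 1) * w ^ N := by
  rcases eq_or_ne w 0 with rfl | hw
  · exact summable_of_ne_finset_zero (s := {0}) fun N hN => by
      simp [zero_pow (by simpa using hN : N ≠ 0)]
  · refine (((summable_nat_add_iff 1).mpr (summable_remainderCoeff hx w)).mul_right w⁻¹).congr
      fun N => ?_
    rw [pow_succ]
    field_simp

/-- The entire function `w ↦ (K(w, x) - exp (I * w ^ 2 / 2)) / w`. -/
noncomputable def kernelRemainder (x : ℝ) (w : ℂ) : ℂ := ∑' N, remainderCoeff x (N + 1) * w ^ N

theorem mul_kernelRemainder {x : ℝ} (hx : x ∈ Set.Icc (-1 : ℝ) 1) (w : ℂ) :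
    w * kernelRemainder x w = ∑' N, remainderCoeff x N * w ^ N := by
  rw [(summable_remainderCoeff hx w).tsum_eq_zero_add, remainderCoeff_zero, kernelRemainder,
    ← tsum_mul_left, zero_mul, zero_add]
  exact tsum_congr fun N => by ring

theorem kernelRemainder_zero (x : ℝ) :
    kernelRemainder x 0 = Real.sqrt Real.pi * x * kernelRoot := by
  rw [kernelRemainder, tsum_eq_single 0 fun N hN => by simp [zero_pow hN]]
  simp [remainderCoeff_one]

theorem radialKernel_four_eq_add {z : ℝ} (hz : 0 < z) {x : ℝ} (hx : x ∈ Set.Icc (-1 : ℝ) 1) :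
    radialKernel 4 4 z x =
      Complex.exp (Complex.I * (z : ℂ) ^ 2 / 2) + z * kernelRemainder x z := by
  have h := (hasSum_kernelCoeff hz hx).sub (hasSum_expCoeff z)
  rw [mul_kernelRemainder hx, eq_comm, ← eq_sub_iff_add_eq', ← h.tsum_eq]
  exact tsum_congr fun N => by rw [remainderCoeff, sub_mul]

theorem hasDerivAt_kernelRemainder {x : ℝ} (hx : x ∈ Set.Icc (-1 : ℝ) 1) (w : ℂ) :
    HasDerivAt (kernelRemainder x)
      (-(Complex.I * (2 * x ^ 2 - 1)) * (w * kernelRemainder x w)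
        - 2 * Complex.I * x ^ 2 * Complex.exp (Complex.I * w ^ 2 / 2)) w := by
  refine (hasDerivAt_tsum_mul_pow (summable_remainderCoeff_succ hx) w).congr_deriv ?_
  rw [mul_kernelRemainder hx]
  have h := ((summable_remainderCoeff hx w).hasSum.mul_left (-(Complex.I * (2 * x ^ 2 - 1)))).sub
    ((hasSum_expCoeff w).mul_left (2 * Complex.I * x ^ 2))
  refine Eq.trans (tsum_congr fun N => ?_) h.tsum_eq
  rw [add_assoc, one_add_one_eq_two, remainderCoeff_recurrence]
  ring

/-- With this integrating factor both sides have derivative `-2 * I * x ^ 2 * exp (I * (z * x) ^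
2)`, so their difference is constant. -/
theorem kernelRemainder_mul_exp {x : ℝ} (hx : x ∈ Set.Icc (-1 : ℝ) 1) (z : ℝ) :
    kernelRemainder x z * Complex.exp (Complex.I * (2 * x ^ 2 - 1) * (z : ℂ) ^ 2 / 2) =
      -(2 * Complex.I * x * fresnelIntegral (z * x)) := by
  let h : ℝ → ℂ := fun z =>
    kernelRemainder x z * Complex.exp (Complex.I * (2 * x ^ 2 - 1) * (z : ℂ) ^ 2 / 2)
      + 2 * Complex.I * x * fresnelIntegral (z * x)
  have hderiv : ∀ t : ℝ, HasDerivAt h 0 t := fun t => by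
    have h1 : HasDerivAt (fun s : ℝ => (s : ℂ)) 1 t := Complex.ofRealCLM.hasDerivAt
    have hA : HasDerivAt (fun s : ℝ => kernelRemainder x s) _ t :=
      (hasDerivAt_kernelRemainder hx t).comp_ofReal
    have hE := (((h1.pow 2).const_mul (Complex.I * (2 * (x : ℂ) ^ 2 - 1))).div_const 2).cexp
    have hF := ((hasDerivAt_fresnelIntegral (t * x)).scomp t
      ((hasDerivAt_id t).mul_const x)).const_mul (2 * Complex.I * (x : ℂ))
    refine ((hA.mul hE).add hF).congr_deriv ?_
    have he : Complex.exp (Complex.I * ((t * x : ℝ) : ℂ) ^ 2) =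
        Complex.exp (Complex.I * (t : ℂ) ^ 2 / 2)
          * Complex.exp (Complex.I * (2 * (x : ℂ) ^ 2 - 1) * (t : ℂ) ^ 2 / 2) := by
      rw [← Complex.exp_add]
      congr 1
      push_cast
      ring
    rw [he]
    simp
    ring
  have hconst := is_const_of_deriv_eq_zero (fun t => (hderiv t).differentiableAt)
    (fun t => (hderiv t).deriv) z 0
  -- The initial values agree because `I * exp (I * π / 4) = -exp (-I * π / 4)`.
  have h0 : h 0 = 0 := by
    have hroot : Complex.I * Complex.exp (Complex.I * Real.pi / 4) = -kernelRoot := by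
      rw [show Complex.I * Real.pi / 4 = Real.pi / 2 * Complex.I + -(Complex.I * Real.pi / 4) by ring,
        Complex.exp_add, Complex.exp_pi_div_two_mul_I, ← mul_assoc, Complex.I_mul_I, kernelRoot]
      ring
    simp only [h]
    rw [Complex.ofReal_zero, kernelRemainder_zero, zero_mul, fresnelIntegral_eq]
    simp
    linear_combination (Real.sqrt Real.pi * x : ℂ) * hroot
  rw [h0] at hconst
  exact eq_neg_of_add_eq_zero_left hconst

/-! ### Closed form and growth -/

theorem radialKernel_four_eq {z : ℝ} (hz : 0 < z) {x : ℝ} (hx : x ∈ Set.Icc (-1 : ℝ) 1) :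
    radialKernel 4 4 z x = Complex.exp (Complex.I * (z : ℂ) ^ 2 / 2)
      - 2 * Complex.I * z * x
        * Complex.exp (-(Complex.I / 2 * (z : ℂ) ^ 2 * (2 * (x : ℂ) ^ 2 - 1)))
        * fresnelIntegral (z * x) := by
  have h := kernelRemainder_mul_exp hx z
  have he : Complex.exp (Complex.I * (2 * x ^ 2 - 1) * (z : ℂ) ^ 2 / 2)
      * Complex.exp (-(Complex.I / 2 * (z : ℂ) ^ 2 * (2 * (x : ℂ) ^ 2 - 1))) = 1 := by
    rw [← Complex.exp_add, ← Complex.exp_zero]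
    congr 1
    ring
  rw [radialKernel_four_eq_add hz hx]
  linear_combination
    z * Complex.exp (-(Complex.I / 2 * (z : ℂ) ^ 2 * (2 * (x : ℂ) ^ 2 - 1))) * h
      - z * kernelRemainder x z * he

theorem isBigO_radialKernel_four_one :
    (fun z : ℝ => radialKernel 4 4 z 1) =O[atTop] (fun z : ℝ => z) := by
  obtain ⟨C, hC⟩ := isBigO_fresnelIntegral_one.bound
  -- Both exponentials are unimodular: `2 * C` comes from the Fresnel term, and 1 from the free
  -- exponential, as `1 ≤ z`.
  refine Asymptotics.IsBigO.of_bound (1 + 2 * C) ?_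
  filter_upwards [hC, eventually_ge_atTop 1] with z hz hz1
  have hz0 : 0 < z := by linarith
  have hexp : ∀ r : ℝ, ‖Complex.exp (Complex.I * r)‖ = 1 := fun r => by
    rw [mul_comm, Complex.norm_exp_ofReal_mul_I]
  rw [radialKernel_four_eq hz0 (by norm_num), mul_one,
    show Complex.I * (z : ℂ) ^ 2 / 2 = Complex.I * (z ^ 2 / 2 : ℝ) by push_cast; ring,
    show -(Complex.I / 2 * (z : ℂ) ^ 2 * (2 * ((1 : ℝ) : ℂ) ^ 2 - 1))
      = Complex.I * (-z ^ 2 / 2 : ℝ) by push_cast; ring]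
  refine (norm_sub_le _ _).trans ?_
  simp only [norm_mul, hexp, Complex.norm_I, Complex.norm_ofNat, Complex.norm_real,
    Real.norm_eq_abs, abs_of_pos hz0, abs_one, mul_one] at hz ⊢
  nlinarith

theorem theorem2p3 :
    (∀ u : ℝ, Tendsto (fun A : ℝ => ∫ t in A..u, Complex.exp (Complex.I * (t : ℂ) ^ 2))
      atBot (𝓝 (fresnelIntegral u))) ∧
    (∀ z : ℝ, 0 < z → ∀ ξ ∈ Set.Icc (-1 : ℝ) 1,
      Summable (kernelTerm 4 4 z ξ) ∧
      radialKernel 4 4 z ξ =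
        Complex.exp (-(Complex.I * (z : ℂ) ^ 2 * ((ξ : ℂ) ^ 2 - 1 / 2)))
          * (-(2 * Complex.I * z * ξ * fresnelIntegral (z * ξ))
            + Complex.exp (Complex.I * (z : ℂ) ^ 2 * (ξ : ℂ) ^ 2))) ∧
    (∀ z : ℝ, 0 < z → ∀ θ : ℝ,
      radialKernel 4 4 z (Real.cos θ) =
        Complex.exp (Complex.I * (z : ℂ) ^ 2 / 2)
          - 2 * Complex.I * z * (Real.cos θ : ℂ)
            * Complex.exp (-(Complex.I / 2 * (z : ℂ) ^ 2 * (Real.cos (2 * θ) : ℂ)))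
            * fresnelIntegral (z * Real.cos θ)) ∧
    (fun z : ℝ => radialKernel 4 4 z 1) =O[atTop] (fun z : ℝ => z) := by
  refine ⟨fun u => ?_, fun z hz ξ hξ => ⟨summable_kernelTerm_four hz hξ, ?_⟩, fun z hz θ => ?_,
    isBigO_radialKernel_four_one⟩
  · rw [fresnelIntegral_eq]
    exact tendsto_integral_cexp_I_mul_sq_atBot u
  · rw [radialKernel_four_eq hz hξ, mul_add, ← Complex.exp_add,
      show -(Complex.I / 2 * (z : ℂ) ^ 2 * (2 * (ξ : ℂ) ^ 2 - 1))
        = -(Complex.I * (z : ℂ) ^ 2 * ((ξ : ℂ) ^ 2 - 1 / 2)) by ring,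
      show -(Complex.I * (z : ℂ) ^ 2 * ((ξ : ℂ) ^ 2 - 1 / 2)) + Complex.I * (z : ℂ) ^ 2 * ξ ^ 2
        = Complex.I * (z : ℂ) ^ 2 / 2 by ring]
    ring
  · rw [radialKernel_four_eq hz ⟨Real.neg_one_le_cos θ, Real.cos_le_one θ⟩, Real.cos_two_mul]
    push_cast
    rfl
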